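/- Let $\mathcal N=\omega^\omega$ and let $T$ be a tree on $\omega\times\omega\times\omega$, that is, a set of finite sequences of elements of $\omega\times\omega\times\omega$ (viewed as triples $\langle u,v,s\rangle$ of sequences of the same length) that is closed under initial segments. Let $\preceq_T$ be the analytic relation $\mathrm{pr}[T]$ on $\mathcal N$: $$x\preceq_T y\iff\exists f\in\omega^\omega\ \forall m\ \ \langle x{\restriction}m,\,y{\restriction}m,\,f{\restriction}m\rangle\in T,$$ and assume that $\preceq_T$ is a partial quasi-order (reflexive and transitive) on $\mathcal N$. For $x,y\in\mathcal N$ let $T_{xy}$ be the tree of all $s\in\omega^{<\omega}$ with $\langle x{\restriction}m,y{\restriction}m,s\rangle\in T$, where $m$ is the length of $s$. If $T_{xy}$ is well-founded, the rank of a node $t$ is $\rho(t)=\sup\{\rho(s)+1: s\in T_{xy},\ s\supsetneq t\}$, and the rank of $T_{xy}$ is $\sup\{\rho(s)+1:s\in T_{xy}\}$. For an ordinal $\nu<\omega_1$ put $$x\preceq_T^\nu y\iff \text{it is not the case that } T_{xy}\text{ is well-founded of rank}\le\nu .$$ Then every $\preceq_T^\nu$ $(\nu<\omega_1)$ is a Borel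 subset of $\mathcal N^2$; ${\preceq_T^\mu}\subseteq{\preceq_T^\nu}$ whenever $\nu<\mu<\omega_1$; and ${\preceq_T}=\bigcap_{\nu<\omega_1}{\preceq_T^\nu}$. Moreover, if $B\subseteq\mathcal N^2$ is a Borel set with ${\preceq_T}\subseteq B$, then there is $\nu<\omega_1$ such that ${\preceq_T^\nu}\subseteq B$ and $\preceq_T^\nu$ is a partial quasi-order on $\mathcal N$. -/

import Mathlib

/-- The set `[T]` of branches of a tree `T` on `ω × ω × ω`: all triples `(x, y, f)` of elements of
Baire space such that the node `(x ↾ m, y ↾ m, f ↾ m)` belongs to `T` for every `m`. -/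
def IsBranch (T : Descriptive.tree (ℕ × ℕ × ℕ)) (x y f : ℕ → ℕ) : Prop :=
  ∀ m : ℕ, List.ofFn (fun i : Fin m => (x i, y i, f i)) ∈ T

/-- The binary relation `pr[T]` on Baire space: the projection of `[T]` along the third
coordinate. -/
def projRel (T : Descriptive.tree (ℕ × ℕ × ℕ)) (x y : ℕ → ℕ) : Prop :=
  ∃ f : ℕ → ℕ, IsBranch T x y f

/-- The section tree `T_{xy}` of all finite sequences `s` such that, with `m` the length of `s`,
the node `(x ↾ m, y ↾ m, s)` belongs to `T`. -/
def sectionTree (T : Descriptive.tree (ℕ × ℕ × ℕ)) (x y : ℕ → ℕ) : Set (List ℕ) :=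
  {s | List.ofFn (fun i : Fin s.length => (x i, y i, s.get i)) ∈ T}

/-- `ProperExt A s t`: the node `s` of `A` is a proper extension of the node `t` of `A`. -/
def ProperExt (A : Set (List ℕ)) (s t : A) : Prop :=
  t.1 <+: s.1 ∧ t.1 ≠ s.1

/-- `A` is a well-founded tree of rank at most `ν`. The rank of a node `t` of a well-founded
tree is the supremum of `rank s + 1` over the proper extensions `s` of `t`, and the rank of the
tree is the supremum of `rank s + 1` over all its nodes `s`. -/
def WellFoundedRankLE (A : Set (List ℕ)) (ν : Ordinal.{0}) : Prop :=
  ∃ _ : IsWellFounded A (ProperExt A), ∀ s : A, IsWellFounded.rank (ProperExt A) s < ν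

/-- The `ν`-th upper approximation of `pr[T]`: the complement of the set of all pairs `(x, y)`
whose section tree `T_{xy}` is well-founded of rank at most `ν`. -/
def approxRel (T : Descriptive.tree (ℕ × ℕ × ℕ)) (ν : Ordinal.{0}) (x y : ℕ → ℕ) : Prop :=
  ¬ WellFoundedRankLE (sectionTree T x y) ν

open Set Ordinal

/-! The engine is boundedness (`exists_rank_bound_of_analyticSet`): if the trees of a closed family
have no branches over an analytic set of parameters, their ranks there are bounded below `ω₁`.
Applied to a singleton, it gives the intersection formula; applied to the complement of `B`, some
`μ` with `approxRel T μ` inside `B`. For transitivity, consider the Borel set of triples `(x, y, z)`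
for which `approxRel T μ x z` fails. A branch of the product of `T_{xy}` and `T_{yz}` would give `x
⪯ y ⪯ z`, hence `x ⪯ z`, so these products have ranks bounded by some `ν < ω₁`. A product has rank
at most `α` only if a factor does (`NodeRankLE.of_prodTree`), so two `ν`-steps compose to a
`μ`-step. Iterating `μ ↦ ν` and taking the supremum gives a transitive approximation. `NodeRankLE`
is defined by recursion on the ordinal, without assuming well-foundedness, so that Borelness follows
by induction. -/

/-- The node `s` has rank at most `α` in the tree `A`. -/
def NodeRankLE {ι : Type*} (A : Set (List ι)) (α : Ordinal.{0}) (s : List ι) : Prop :=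
  ∀ t ∈ A, s <+: t → s ≠ t → ∃ β : Set.Iio α, NodeRankLE A β.1 t
termination_by α
decreasing_by exact β.2

theorem nodeRankLE_iff {ι : Type*} {A : Set (List ι)} {α : Ordinal.{0}} {s : List ι} :
    NodeRankLE A α s ↔ ∀ t ∈ A, s <+: t → s ≠ t → ∃ β < α, NodeRankLE A β t := by
  rw [NodeRankLE]
  simp only [Subtype.exists, Set.mem_Iio, exists_prop]

/-- The set `A` of finite sequences is closed under initial segments. -/
def PrefixClosed {ι : Type*} (A : Set (List ι)) : Prop :=
  ∀ s t, s <+: t → t ∈ A → s ∈ A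

/-- The sequence `f` is an infinite branch of `A`. -/
def HasBranch {ι : Type*} (A : Set (List ι)) (f : ℕ → ι) : Prop :=
  ∀ m, List.ofFn (fun i : Fin m => f i) ∈ A

section Rank

variable {ι : Type*} {A : Set (List ι)}

theorem NodeRankLE.mono_prefix {α : Ordinal.{0}} {s t : List ι} (h : NodeRankLE A α s)
    (hst : s <+: t) : NodeRankLE A α t := by
  rw [nodeRankLE_iff] at h ⊢
  intro u hu htu hne
  refine h u hu (hst.trans htu) ?_
  rintro rfl
  exact hne (htu.eq_of_length_le hst.length_le)

theorem nodeRankLE_of_rankFunction {φ : List ι → Ordinal.{0}}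
    (hφ : ∀ s t, t ∈ A → s <+: t → s ≠ t → φ t < φ s) (s : List ι) : NodeRankLE A (φ s) s := by
  induction h : φ s using WellFoundedLT.induction generalizing s with
  | _ α ih =>
    subst h
    rw [nodeRankLE_iff]
    intro t ht hst hne
    exact ⟨φ t, hφ s t ht hst hne, ih _ (hφ s t ht hst hne) t rfl⟩

theorem exists_hasBranch_of_chain (hA : PrefixClosed A) {s : ℕ → List ι}
    (hs : ∀ n, s (n + 1) ∈ A ∧ s n <+: s (n + 1) ∧ s n ≠ s (n + 1)) :
    ∃ f, HasBranch A f := by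
  have hlen : ∀ n, n ≤ (s n).length := by
    intro n
    induction n with
    | zero => exact Nat.zero_le _
    | succ n ih =>
      rcases lt_or_eq_of_le (hs n).2.1.length_le with h | h
      · omega
      · exact absurd ((hs n).2.1.eq_of_length h) (hs n).2.2
  have hmono : ∀ m n, m ≤ n → s m <+: s n := by
    intro m n hmn
    induction n, hmn using Nat.le_induction with
    | base => exact List.prefix_rfl
    | succ n _ ih => exact ih.trans (hs n).2.1
  -- The term `s (n + 1)` has length at least `n + 1`, so its entry `n` exists and is never changed
  -- later.
  refine ⟨fun n => (s (n + 1))[n]'(hlen (n + 1)), fun m => ?_⟩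
  refine hA _ (s (m + 1)) ?_ (hs m).1
  have : List.ofFn (fun i : Fin m => (s (i + 1))[(i : ℕ)]'(hlen (i + 1))) =
      (s (m + 1)).take m := by
    apply List.ext_getElem
    · have := hlen (m + 1)
      simp; omega
    · intro i h1 h2
      simp only [List.length_ofFn] at h1
      simp only [List.getElem_ofFn, List.getElem_take]
      exact (hmono (i + 1) (m + 1) (by omega)).getElem (hlen (i + 1))
  rw [this]
  exact List.take_prefix _ _

/-- There are only countably many nodes, and a countable supremum of countable ordinals is
countable. -/
theorem exists_rankFunction_lt_omega_one [Countable ι] (hA : PrefixClosed A)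
    (hb : ∀ f, ¬ HasBranch A f) :
    ∃ φ : List ι → Ordinal.{0}, (∃ ν < ω_ 1, ∀ s, φ s < ν) ∧
      ∀ s t, t ∈ A → s <+: t → s ≠ t → φ t < φ s := by
  let r : List ι → List ι → Prop := fun t s => t ∈ A ∧ s <+: t ∧ s ≠ t
  have hwf : WellFounded r := by
    rw [wellFounded_iff_isEmpty_descending_chain]
    refine ⟨fun ⟨s, hs⟩ => ?_⟩
    obtain ⟨f, hf⟩ := exists_hasBranch_of_chain hA hs
    exact hb f hf
  -- Coding nodes by naturals places the ranks in `Ordinal.{0}`, whatever the universe of `ι`.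
  let e : List ι → ℕ := (Countable.exists_injective_nat (List ι)).choose
  have he : Function.Injective e := (Countable.exists_injective_nat (List ι)).choose_spec
  let q : e '' univ → e '' univ → Prop := fun a b => r a.2.choose b.2.choose
  have hch : ∀ s, (⟨e s, s, mem_univ s, rfl⟩ : e '' univ).2.choose = s := fun s =>
    he (⟨e s, s, mem_univ s, rfl⟩ : e '' univ).2.choose_spec.2
  have hq : IsWellFounded _ q := ⟨InvImage.wf (fun a : e '' univ => a.2.choose) hwf⟩
  have hlt : ∀ a, IsWellFounded.rank q a < ω_ 1 := by
    intro a
    induction a using hq.wf.induction with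
    | _ a ih =>
      rw [IsWellFounded.rank_eq]
      refine iSup_lt_omega_one fun b => ?_
      exact (Cardinal.isSuccLimit_omega 1).succ_lt (ih b.1 b.2)
  refine ⟨fun s => IsWellFounded.rank q ⟨e s, s, mem_univ s, rfl⟩,
    ⟨⨆ a, Order.succ (IsWellFounded.rank q a), ?_, ?_⟩, ?_⟩
  · exact iSup_lt_omega_one fun b => (Cardinal.isSuccLimit_omega 1).succ_lt (hlt b)
  · intro s
    exact (Order.lt_succ _).trans_le
      (Ordinal.le_iSup (fun a => Order.succ (IsWellFounded.rank q a)) _)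
  · intro s t ht hst hne
    apply IsWellFounded.rank_lt_of_rel
    change r _ _
    rw [hch, hch]
    exact ⟨ht, hst, hne⟩

end Rank

/-- Boundedness: the ranks of the trees in a closed family are bounded below `ω₁` on every analytic
set of parameters on which the trees have no branches. -/
theorem exists_rank_bound_of_analyticSet {ι X : Type*} [Countable ι] [TopologicalSpace X]
    {S : X → Set (List ι)} (hS : ∀ p, PrefixClosed (S p)) (hc : ∀ s, IsClosed {p | s ∈ S p})
    {A : Set X} (hA : MeasureTheory.AnalyticSet A) (hb : ∀ p ∈ A, ∀ f, ¬ HasBranch (S p) f) :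
    ∃ ν < ω_ 1, ∀ p ∈ A, ∃ β < ν, NodeRankLE (S p) β [] := by
  rw [MeasureTheory.AnalyticSet] at hA
  rcases hA with rfl | ⟨g, hg, rfl⟩
  · exact ⟨0, omega_pos 1, fun p hp => hp.elim⟩
  -- One countable tree searches for a code `w` of a parameter together with a branch of `S (g w)`.
  -- The witnesses `w` along a branch of `U` converge, and closedness passes membership to the
  -- limit.
  let U : Set (List (ℕ × ι)) := {l | ∃ w : ℕ → ℕ, (∀ i (h : i < l.length), l[i].1 = w i) ∧
    l.map Prod.snd ∈ S (g w)}
  have hU : PrefixClosed U := by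
    rintro s t hst ⟨w, hw, ht⟩
    refine ⟨w, fun i h => ?_, hS _ _ _ (hst.map _) ht⟩
    rw [hst.getElem h]
    exact hw i _
  have hbU : ∀ f, ¬ HasBranch U f := by
    intro f hf
    refine hb (g fun n => (f n).1) (mem_range_self _) (fun n => (f n).2) fun m => ?_
    choose w hw hmem using hf
    have hlim : Filter.Tendsto w Filter.atTop (nhds fun n => (f n).1) := by
      rw [tendsto_pi_nhds]
      intro n
      apply tendsto_const_nhds.congr'
      filter_upwards [Filter.eventually_gt_atTop n] with k hk
      have := hw k n (by simpa using hk)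
      simpa using this
    have hcl := (hc (List.ofFn fun i : Fin m => (f i).2)).preimage hg
    refine hcl.mem_of_tendsto hlim ?_
    filter_upwards [Filter.eventually_ge_atTop m] with k hk
    refine hS _ _ _ ?_ (hmem k)
    have : (List.ofFn fun i : Fin m => (f i).2) =
        (List.map Prod.snd (List.ofFn fun i : Fin k => f i)).take m := by
      apply List.ext_getElem
      · simp [hk]
      · intro i h1 h2
        simp
    rw [this]
    exact List.take_prefix _ _
  obtain ⟨φ, ⟨ν, hν, hφν⟩, hφ⟩ := exists_rankFunction_lt_omega_one hU hbU
  refine ⟨ν, hν, ?_⟩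
  rintro _ ⟨w, rfl⟩
  -- Pairing nodes with `w` embeds `S (g w)` into `U`, so the rank function of `U` pulls back.
  let z : List ι → List (ℕ × ι) := fun s => s.mapIdx fun i a => (w i, a)
  refine ⟨φ (z []), hφν _, nodeRankLE_of_rankFunction (φ := φ ∘ z) ?_ []⟩
  have hz : ∀ s, (z s).map Prod.snd = s := by
    intro s
    apply List.ext_getElem <;> simp [z]
  intro s t ht hst hne
  refine hφ _ _ ⟨w, ?_, by rwa [hz]⟩ ?_ ?_
  · intro i h
    simp [z]
  · obtain ⟨u, rfl⟩ := hst
    simp only [z, List.mapIdx_append]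
    exact List.prefix_append _ _
  · intro h
    apply hne
    rw [← hz s, ← hz t, h]

/-! ### Ranks in product trees -/

/-- The product of two trees, consisting of the pairs of nodes of equal length. -/
def prodTree {ι κ : Type*} (A : Set (List ι)) (B : Set (List κ)) : Set (List (ι × κ)) :=
  {l | l.map Prod.fst ∈ A ∧ l.map Prod.snd ∈ B}

theorem PrefixClosed.prodTree {ι κ : Type*} {A : Set (List ι)} {B : Set (List κ)}
    (hA : PrefixClosed A) (hB : PrefixClosed B) : PrefixClosed (prodTree A B) :=
  fun _ _ hst ht => ⟨hA _ _ (hst.map _) ht.1, hB _ _ (hst.map _) ht.2⟩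

theorem HasBranch.fst {ι κ : Type*} {A : Set (List ι)} {B : Set (List κ)} {f : ℕ → ι × κ}
    (h : HasBranch (prodTree A B) f) : HasBranch A fun n => (f n).1 := by
  intro m
  have := (h m).1
  rwa [List.map_ofFn] at this

theorem HasBranch.snd {ι κ : Type*} {A : Set (List ι)} {B : Set (List κ)} {f : ℕ → ι × κ}
    (h : HasBranch (prodTree A B) f) : HasBranch B fun n => (f n).2 := by
  intro m
  have := (h m).2
  rwa [List.map_ofFn] at this

theorem List.IsPrefix.length_lt_of_ne {ι : Type*} {s t : List ι} (h : s <+: t) (hne : s ≠ t) :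
    s.length < t.length :=
  lt_of_le_of_ne h.length_le fun h' => hne (h.eq_of_length h')

theorem NodeRankLE.of_prodTree {ι κ : Type*} {A : Set (List ι)} {B : Set (List κ)}
    (hA : PrefixClosed A) (hB : PrefixClosed B) {α : Ordinal.{0}} {l : List (ι × κ)}
    (h : NodeRankLE (prodTree A B) α l) :
    NodeRankLE A α (l.map Prod.fst) ∨ NodeRankLE B α (l.map Prod.snd) := by
  induction α using WellFoundedLT.induction generalizing l with
  | _ α ih =>
    by_contra! hcon
    rw [nodeRankLE_iff, nodeRankLE_iff] at hcon
    push Not at hcon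
    obtain ⟨⟨t, ht, hlt, hnet, hrt⟩, ⟨u, hu, hlu, hneu, hru⟩⟩ := hcon
    have htl := hlt.length_lt_of_ne hnet
    have hul := hlu.length_lt_of_ne hneu
    rw [List.length_map] at htl hul
    -- Cutting the two bad extensions to a common length makes their zip a proper extension of `l`
    -- in the product; a rank bound for a truncation passes up to `t` or `u`.
    let k := min t.length u.length
    have hk1 : (t.take k).length = k := by simp [k]
    have hk2 : (u.take k).length = k := by simp [k]
    let m := (t.take k).zip (u.take k)
    have hm1 : m.map Prod.fst = t.take k := List.map_fst_zip (by omega)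
    have hm2 : m.map Prod.snd = u.take k := List.map_snd_zip (by omega)
    have hmS : m ∈ prodTree A B :=
      ⟨hm1 ▸ hA _ _ (List.take_prefix _ _) ht, hm2 ▸ hB _ _ (List.take_prefix _ _) hu⟩
    have hmlen : m.length = k := by simp [m, k]
    have hlm : l <+: m := by
      rw [List.prefix_iff_getElem]
      refine ⟨by omega, fun i hi => ?_⟩
      have h1 := hlt.getElem (i := i) (by simpa using hi)
      have h2 := hlu.getElem (i := i) (by simpa using hi)
      simp only [List.getElem_map] at h1 h2
      simp [m, Prod.ext_iff, h1, h2]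
    obtain ⟨β, hβ, hr⟩ := nodeRankLE_iff.1 h m hmS hlm (by rintro rfl; omega)
    rcases ih β hβ hr with hr | hr
    · rw [hm1] at hr
      exact hrt β hβ (hr.mono_prefix (List.take_prefix _ _))
    · rw [hm2] at hr
      exact hru β hβ (hr.mono_prefix (List.take_prefix _ _))

/-- The root has the largest rank, so the tree has rank one more than the root. The empty tree, of
rank `0`, must be excluded: at `ν = 0` no `β < ν` exists. -/
theorem wellFoundedRankLE_iff {A : Set (List ℕ)} (hA : [] ∈ A) {ν : Ordinal.{0}} :
    WellFoundedRankLE A ν ↔ ∃ β < ν, NodeRankLE A β [] := by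
  constructor
  · rintro ⟨hwf, hν⟩
    have key : ∀ s : A, NodeRankLE A (IsWellFounded.rank (ProperExt A) s) s.1 := by
      intro s
      induction s using hwf.wf.induction with
      | _ s ih =>
        rw [nodeRankLE_iff]
        intro t ht hst hne
        exact ⟨_, IsWellFounded.rank_lt_of_rel (r := ProperExt A) (a := ⟨t, ht⟩) ⟨hst, hne⟩,
          ih ⟨t, ht⟩ ⟨hst, hne⟩⟩
    exact ⟨_, hν ⟨[], hA⟩, key _⟩
  · rintro ⟨β, hβ, h⟩
    -- The least admissible bound strictly decreases along extensions, which proves well-foundedness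
    -- and dominates the rank.
    let φ : A → Ordinal.{0} := fun s => sInf {α | NodeRankLE A α s.1}
    have hφ : ∀ s : A, NodeRankLE A (φ s) s.1 := fun s =>
      csInf_mem (s := {α | NodeRankLE A α s.1}) ⟨β, h.mono_prefix List.nil_prefix⟩
    have hle : ∀ (s : A) α, NodeRankLE A α s.1 → φ s ≤ α := fun s α hs => csInf_le' hs
    have hdec : ∀ t s : A, ProperExt A t s → φ t < φ s := by
      intro t s hts
      obtain ⟨γ, hγ, hr⟩ := nodeRankLE_iff.1 (hφ s) t.1 t.2 hts.1 hts.2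
      exact (hle t γ hr).trans_lt hγ
    have hwf : IsWellFounded A (ProperExt A) :=
      ⟨Subrelation.wf (fun {t s} h => hdec t s h) (InvImage.wf φ Ordinal.lt_wf)⟩
    refine ⟨hwf, fun s => lt_of_le_of_lt ?_ hβ⟩
    refine le_trans ?_ (hle s β (h.mono_prefix List.nil_prefix))
    induction s using hwf.wf.induction with
    | _ s ih =>
      rw [IsWellFounded.rank_eq]
      exact Ordinal.iSup_le fun t => Order.succ_le_of_lt ((ih t.1 t.2).trans_lt (hdec _ _ t.2))

theorem countable_Iio_of_lt_omega_one {α : Ordinal.{0}} (hα : α < ω_ 1) :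
    (Set.Iio α).Countable := by
  rw [← Cardinal.le_aleph0_iff_set_countable, Cardinal.mk_Iio_ordinal, Cardinal.lift_le_aleph0,
    ← Order.lt_succ_iff, Cardinal.succ_aleph0, ← Cardinal.lt_ord, Cardinal.ord_aleph]
  exact hα

theorem measurableSet_nodeRankLE {ι X : Type*} [Countable ι] [MeasurableSpace X]
    {S : X → Set (List ι)} (hS : ∀ s, MeasurableSet {p | s ∈ S p}) {α : Ordinal.{0}}
    (hα : α < ω_ 1) (s : List ι) : MeasurableSet {p | NodeRankLE (S p) α s} := by
  induction α using WellFoundedLT.induction generalizing s with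
  | _ α ih =>
    have hcount : (Set.Iio α).Countable := countable_Iio_of_lt_omega_one hα
    have : {p | NodeRankLE (S p) α s} = ⋂ t : List ι, ({p | t ∈ S p}ᶜ ∪
        {_p | s <+: t → s = t} ∪ ⋃ β ∈ Set.Iio α, {p | NodeRankLE (S p) β t}) := by
      ext p
      rw [mem_ofPred_eq, nodeRankLE_iff]
      simp only [mem_iInter, mem_union, mem_compl_iff, mem_ofPred_eq, mem_iUnion, exists_prop,
        mem_Iio]
      refine forall_congr' fun t => ?_
      tauto
    rw [this]
    exact MeasurableSet.iInter fun t => ((hS t).compl.union (MeasurableSet.const _)).union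
      (MeasurableSet.biUnion hcount fun β hβ => ih β hβ (hβ.trans hα) t)

/-! ### The section trees and the approximations -/

section SectionTree

variable (T : Descriptive.tree (ℕ × ℕ × ℕ))

theorem prefixClosed_sectionTree (x y : ℕ → ℕ) : PrefixClosed (sectionTree T x y) := by
  intro s t hst ht
  refine Descriptive.Tree.mem_of_prefix ?_ ht
  rw [List.prefix_iff_getElem]
  refine ⟨by simpa using hst.length_le, fun i hi => ?_⟩
  simp only [List.length_ofFn] at hi
  simp [hst.getElem hi]

theorem hasBranch_sectionTree_iff {x y f : ℕ → ℕ} :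
    HasBranch (sectionTree T x y) f ↔ IsBranch T x y f := by
  refine forall_congr' fun m => ?_
  have : (List.ofFn fun i : Fin (List.ofFn fun i : Fin m => f i).length =>
      (x i, y i, (List.ofFn fun i : Fin m => f i).get i)) =
      List.ofFn fun i : Fin m => (x i, y i, f i) := by
    apply List.ext_getElem <;> simp
  change List.ofFn _ ∈ T ↔ _
  rw [this]

theorem isClosed_setOf_mem_sectionTree (s : List ℕ) :
    IsClosed {p : (ℕ → ℕ) × (ℕ → ℕ) | s ∈ sectionTree T p.1 p.2} := by
  let g : (ℕ → ℕ) × (ℕ → ℕ) → Fin s.length → ℕ × ℕ := fun p i => (p.1 i, p.2 i)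
  have hg : Continuous g := by fun_prop
  exact (isClosed_discrete
    {v : Fin s.length → ℕ × ℕ | List.ofFn (fun i => ((v i).1, (v i).2, s.get i)) ∈ T}).preimage hg

variable {T}

theorem nil_mem_sectionTree {x₀ y₀ : ℕ → ℕ} (h : projRel T x₀ y₀) (x y : ℕ → ℕ) :
    [] ∈ sectionTree T x y := by
  obtain ⟨f, hf⟩ := h
  simpa [sectionTree] using hf 0

theorem projRel.approxRel {x y : ℕ → ℕ} (h : projRel T x y) (ν : Ordinal.{0}) :
    approxRel T ν x y := by
  rintro ⟨hwf, -⟩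
  obtain ⟨f, hf⟩ := h
  rw [← hasBranch_sectionTree_iff] at hf
  refine (wellFounded_iff_isEmpty_descending_chain.1 hwf.wf).elim
    ⟨fun n => ⟨_, hf n⟩, fun n => ⟨?_, fun h => ?_⟩⟩
  · rw [List.prefix_iff_getElem]
    exact ⟨by simp, fun i hi => by simp only [List.getElem_ofFn]⟩
  · simpa using congrArg List.length h

theorem approxRel.mono {ν μ : Ordinal.{0}} (h : ν ≤ μ) {x y : ℕ → ℕ} (hxy : approxRel T μ x y) :
    approxRel T ν x y :=
  fun ⟨hwf, hr⟩ => hxy ⟨hwf, fun s => (hr s).trans_le h⟩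

variable (hnil : ∀ x y, [] ∈ sectionTree T x y)

include hnil

theorem approxRel_iff {ν : Ordinal.{0}} {x y : ℕ → ℕ} :
    approxRel T ν x y ↔ ¬ ∃ β < ν, NodeRankLE (sectionTree T x y) β [] := by
  rw [approxRel, wellFoundedRankLE_iff (hnil x y)]

theorem measurableSet_approxRel {ν : Ordinal.{0}} (hν : ν < ω_ 1) :
    MeasurableSet {p : (ℕ → ℕ) × (ℕ → ℕ) | approxRel T ν p.1 p.2} := by
  have hcount : (Set.Iio ν).Countable := countable_Iio_of_lt_omega_one hν
  have : {p : (ℕ → ℕ) × (ℕ → ℕ) | approxRel T ν p.1 p.2} =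
      (⋃ β ∈ Set.Iio ν, {p | NodeRankLE (sectionTree T p.1 p.2) β []})ᶜ := by
    ext p
    simp [approxRel_iff hnil]
  rw [this]
  exact (MeasurableSet.biUnion hcount fun β hβ => measurableSet_nodeRankLE
    (fun s => (isClosed_setOf_mem_sectionTree T s).measurableSet) (hβ.trans hν) []).compl

/-- An analytic set disjoint from `pr[T]` is disjoint from one of the approximations. -/
theorem exists_disjoint_approxRel {A : Set ((ℕ → ℕ) × (ℕ → ℕ))}
    (hA : MeasureTheory.AnalyticSet A) (hd : ∀ x y, (x, y) ∈ A → ¬ projRel T x y) :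
    ∃ ν < ω_ 1, ∀ x y, (x, y) ∈ A → ¬ approxRel T ν x y := by
  obtain ⟨ν, hν, h⟩ := exists_rank_bound_of_analyticSet
    (fun p : (ℕ → ℕ) × (ℕ → ℕ) => prefixClosed_sectionTree T p.1 p.2)
    (isClosed_setOf_mem_sectionTree T) hA
    (fun p hp f hf => hd p.1 p.2 hp ⟨f, (hasBranch_sectionTree_iff T).1 hf⟩)
  refine ⟨ν, hν, fun x y hxy => ?_⟩
  rw [approxRel_iff hnil, not_not]
  exact h _ hxy

theorem exists_approxRel_trans (htrans : ∀ x y z, projRel T x y → projRel T y z → projRel T x z)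
    {μ : Ordinal.{0}} (hμ : μ < ω_ 1) :
    ∃ ν < ω_ 1, ∀ x y z, approxRel T ν x y → approxRel T ν y z → approxRel T μ x z := by
  let A : Set ((ℕ → ℕ) × (ℕ → ℕ) × (ℕ → ℕ)) := {p | ¬ approxRel T μ p.1 p.2.2}
  have hA : MeasureTheory.AnalyticSet A := by
    have : BorelSpace ((ℕ → ℕ) × (ℕ → ℕ)) := Prod.borelSpace
    have : BorelSpace ((ℕ → ℕ) × (ℕ → ℕ) × (ℕ → ℕ)) := Prod.borelSpace
    have hf : Measurable fun p : (ℕ → ℕ) × (ℕ → ℕ) × (ℕ → ℕ) => (p.1, p.2.2) := by fun_prop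
    exact (hf (measurableSet_approxRel hnil hμ)).compl.analyticSet
  obtain ⟨ν, hν, h⟩ := exists_rank_bound_of_analyticSet (A := A)
    (S := fun p => prodTree (sectionTree T p.1 p.2.1) (sectionTree T p.2.1 p.2.2))
    (fun p => (prefixClosed_sectionTree T _ _).prodTree (prefixClosed_sectionTree T _ _))
    (fun s => by
      have h1 : Continuous fun p : (ℕ → ℕ) × (ℕ → ℕ) × (ℕ → ℕ) => (p.1, p.2.1) := by fun_prop
      have h2 : Continuous fun p : (ℕ → ℕ) × (ℕ → ℕ) × (ℕ → ℕ) => p.2 := by fun_prop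
      exact ((isClosed_setOf_mem_sectionTree T (s.map Prod.fst)).preimage h1).inter
        ((isClosed_setOf_mem_sectionTree T (s.map Prod.snd)).preimage h2))
    hA (fun p hp f hf => hp <| projRel.approxRel (htrans _ _ _
      ⟨_, (hasBranch_sectionTree_iff T).1 hf.fst⟩ ⟨_, (hasBranch_sectionTree_iff T).1 hf.snd⟩) μ)
  refine ⟨ν, hν, fun x y z hxy hyz => ?_⟩
  by_contra hxz
  obtain ⟨β, hβ, hr⟩ := h (x, y, z) hxz
  rcases hr.of_prodTree (prefixClosed_sectionTree T _ _) (prefixClosed_sectionTree T _ _) with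
    hr | hr
  · exact (approxRel_iff hnil).1 hxy ⟨β, hβ, hr⟩
  · exact (approxRel_iff hnil).1 hyz ⟨β, hβ, hr⟩

theorem exists_isTrans_approxRel
    (htrans : ∀ x y z, projRel T x y → projRel T y z → projRel T x z)
    {μ : Ordinal.{0}} (hμ : μ < ω_ 1) :
    ∃ ν < ω_ 1, μ ≤ ν ∧
      ∀ x y z, approxRel T ν x y → approxRel T ν y z → approxRel T ν x z := by
  choose F hF hFt using fun o : Set.Iio (ω_ 1) => exists_approxRel_trans hnil htrans o.2
  let u : ℕ → Set.Iio (ω_ 1) := fun n => (fun o => ⟨F o, hF o⟩)^[n] ⟨μ, hμ⟩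
  have hu : ∀ n, (u (n + 1)).1 = F (u n) := fun n => by
    simp only [u, Function.iterate_succ_apply']
  have hle : ∀ n, (u n).1 ≤ ⨆ n, (u n).1 := Ordinal.le_iSup fun n => (u n).1
  refine ⟨⨆ n, (u n).1, iSup_lt_omega_one fun n => (u n).2, hle 0, fun x y z hxy hyz => ?_⟩
  rw [approxRel_iff hnil]
  rintro ⟨β, hβ, hr⟩
  -- A root rank below the supremum is already below some `u n`, while the hypotheses at level `u (n
  -- + 1)` exclude this.
  obtain ⟨n, hn⟩ := Ordinal.lt_iSup_iff.1 hβ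
  have hxz := hFt (u n) x y z (hxy.mono (hu n ▸ hle (n + 1))) (hyz.mono (hu n ▸ hle (n + 1)))
  exact (approxRel_iff hnil).1 hxz ⟨β, hn, hr⟩

end SectionTree

theorem mainTheorem7 (T : Descriptive.tree (ℕ × ℕ × ℕ))
    (hT : IsPreorder (ℕ → ℕ) (projRel T)) :
    (∀ ν < Ordinal.omega 1,
      MeasurableSet {p : (ℕ → ℕ) × (ℕ → ℕ) | approxRel T ν p.1 p.2}) ∧
    (∀ ν μ : Ordinal.{0}, ν < μ → μ < Ordinal.omega 1 →
      ∀ x y : ℕ → ℕ, approxRel T μ x y → approxRel T ν x y) ∧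
    (∀ x y : ℕ → ℕ, projRel T x y ↔ ∀ ν < Ordinal.omega 1, approxRel T ν x y) ∧
    (∀ B : Set ((ℕ → ℕ) × (ℕ → ℕ)), MeasurableSet B →
      (∀ x y : ℕ → ℕ, projRel T x y → (x, y) ∈ B) →
      ∃ ν < Ordinal.omega 1,
        (∀ x y : ℕ → ℕ, approxRel T ν x y → (x, y) ∈ B) ∧
        IsPreorder (ℕ → ℕ) (approxRel T ν)) := by
  have hnil := nil_mem_sectionTree (hT.refl fun _ => 0)
  refine ⟨fun ν hν => measurableSet_approxRel hnil hν, fun ν μ h _ x y => approxRel.mono h.le,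
    fun x y => ⟨fun h ν _ => h.approxRel ν, fun h => ?_⟩, fun B hB hTB => ?_⟩
  · by_contra hxy
    obtain ⟨ν, hν, h'⟩ := exists_disjoint_approxRel hnil (A := {(x, y)})
      isClosed_singleton.analyticSet (by rintro _ _ ⟨rfl, rfl⟩; exact hxy)
    exact h' x y rfl (h ν hν)
  · obtain ⟨μ, hμ, hd⟩ := exists_disjoint_approxRel hnil hB.compl.analyticSet
      (fun x y hxy h => hxy (hTB x y h))
    obtain ⟨ν, hν, hle, htr⟩ := exists_isTrans_approxRel hnil
      (fun x y z hxy hyz => hT.trans x y z hxy hyz) hμ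
    refine ⟨ν, hν, fun x y hxy => ?_, { refl := fun x => ?_, trans := htr }⟩
    · by_contra hB'
      exact hd x y hB' (hxy.mono hle)
    · exact (hT.refl x).approxRel ν
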